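/- Let $n,m\ge 2$ be integers, and let $G,H$ be finitely generated groups with normal subgroups $M\lhd G$, $N\lhd H$ (not assumed to be finitely generated). Suppose that $M$ is not co-amenable in $G$, i.e. that there is no $G$-invariant finitely additive probability measure defined on all subsets of $G/M$. Suppose that there is a quasi-isometry of pairs $(G,M)\to(H,N)$, i.e. a quasi-isometry $f\colon G\to H$ for word metrics associated with finite generating sets, and a constant $Q>0$, such that for every coset $gM$ there is a coset $hN$ with $d_{\mathrm{Haus}}(f(gM),hN)\le Q$, and for every coset $hN$ there is a coset $gM$ with $d_{\mathrm{Haus}}(f(gM),hN)\le Q$. Suppose finally that $n$ and $m$ have the same prime divisors. Write $\mathbb Z_n\wr_{G/M}G=\bigl(\bigoplus_{G/M}\mathbb Z_n\bigr)\rtimes G$, where $G$ permutes the coordinates through left multiplication on $G/M$, and likewise for $\mathbb Z_m\wr_{H/N}H$. Then these two groups are finitely generated and, for word metrics associated with finite generating sets, there exists an aptolic quasi-isometry $$q\colon \mathbb Z_n\wr_{G/M}G\longrightarrow \mathbb Z_m\wr_{H/N}H .$$ Here a map between these groups (in either direction) is of aptolic form if it sends $(c,p)$ to $(\alpha(c),\beta(p))$,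 for a map $\alpha$ between the two direct sums and a map $\beta$ between the two base groups; $q$ is aptolic if it is of aptolic form and has a quasi-inverse of aptolic form. -/

import Mathlib

/-! ### Coarse geometry, for integer-valued distances such as word metrics -/

section Coarse

variable {X Y : Type*}

/-- `f` is a `(C, K)`-quasi-isometry from `(X, dX)` to `(Y, dY)`. -/
def IsQuasiIsometryWith (dX : X → X → ℕ) (dY : Y → Y → ℕ) (C K : ℝ) (f : X → Y) : Prop :=
  (∀ x x' : X, (1 / C) * (dX x x' : ℝ) - K ≤ (dY (f x) (f x') : ℝ) ∧
    (dY (f x) (f x') : ℝ) ≤ C * (dX x x' : ℝ) + K) ∧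
  ∀ y : Y, ∃ x : X, (dY y (f x) : ℝ) ≤ K

/-- `f` is a quasi-isometry from `(X, dX)` to `(Y, dY)`. -/
def IsQuasiIsometry (dX : X → X → ℕ) (dY : Y → Y → ℕ) (f : X → Y) : Prop :=
  ∃ C K : ℝ, 1 ≤ C ∧ 0 ≤ K ∧ IsQuasiIsometryWith dX dY C K f

/-- The quasi-isometry `r` is a quasi-inverse of `q`: both compositions are at finite distance from
the identity. -/
def IsQuasiInverse (dX : X → X → ℕ) (dY : Y → Y → ℕ) (q : X → Y) (r : Y → X) : Prop :=
  IsQuasiIsometry dY dX r ∧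
  ∃ D : ℕ, (∀ x : X, dX (r (q x)) x ≤ D) ∧ ∀ y : Y, dY (q (r y)) y ≤ D

/-- The Hausdorff distance between `A` and `B` is at most `Q`: each of the two sets lies in the
`Q`-neighbourhood of the other. -/
def HausdorffLE (d : X → X → ℕ) (Q : ℝ) (A B : Set X) : Prop :=
  (∀ a ∈ A, ∃ b ∈ B, (d a b : ℝ) ≤ Q) ∧ ∀ b ∈ B, ∃ a ∈ A, (d b a : ℝ) ≤ Q

/-- `f` is a quasi-isometry of pairs from `(X, 𝒜)` to `(Y, ℬ)`, where `𝒜`, `ℬ` are collections of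
subspaces. -/
def IsQuasiIsometryOfPairs (dX : X → X → ℕ) (dY : Y → Y → ℕ)
    (𝒜 : Set (Set X)) (ℬ : Set (Set Y)) (f : X → Y) : Prop :=
  IsQuasiIsometry dX dY f ∧
  ∃ Q : ℝ, 0 < Q ∧
    (∀ A ∈ 𝒜, ∃ B ∈ ℬ, HausdorffLE dY Q (f '' A) B) ∧
    (∀ B ∈ ℬ, ∃ A ∈ 𝒜, HausdorffLE dY Q (f '' A) B)

end Coarse

/-! ### Finitely generated groups, word metrics, cosets -/

section Groups

variable {G : Type*} [Group G]

/-- `S` is a finite generating set of `G`. -/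
def IsFiniteGeneratingSet (S : Set G) : Prop :=
  S.Finite ∧ Subgroup.closure S = ⊤

/-- The word metric on `G` given by a generating set `S`: the path distance in the Cayley graph,
whose edges join `g` to `g * s` for `s ∈ S`. -/
noncomputable def wordDist (S : Set G) (g h : G) : ℕ :=
  (SimpleGraph.mulCayley S).dist g h

/-- The collection of left cosets `g M` of `M`, as subsets of `G`. -/
def leftCosets (M : Subgroup G) : Set (Set G) :=
  {A | ∃ g : G, A = (fun x : G => g * x) '' (M : Set G)}

end Groups

/-! ### Amenable actions -/

/-- The action of `G` on `X` is amenable: there is a `G`-invariant finitely additive probability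
measure defined on all subsets of `X`. -/
def IsAmenableAction (G X : Type*) [Group G] [MulAction G X] : Prop :=
  ∃ μ : Set X → ℝ,
    (∀ A : Set X, 0 ≤ μ A) ∧
    μ Set.univ = 1 ∧
    (∀ A B : Set X, Disjoint A B → μ (A ∪ B) = μ A + μ B) ∧
    ∀ (g : G) (A : Set X), μ ((fun x : X => g • x) '' A) = μ A

/-- `M` is co-amenable in `G`: the left-multiplication action of `G` on `G ⧸ M` is amenable. -/
def IsCoAmenable {G : Type*} [Group G] (M : Subgroup G) : Prop :=
  IsAmenableAction G (G ⧸ M)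

/-! ### Permutational wreath products -/

/-- The direct sum `⨁_X A` of copies of an abelian group `A`, written multiplicatively: finitely
supported colourings of `X` by elements of `A`. -/
abbrev Lamps (A X : Type*) [AddCommGroup A] : Type _ :=
  Multiplicative (X →₀ A)

/-- The action of `G` on `⨁_X A` permuting the coordinates through the action of `G` on `X`:
`(g • c) (g • x) = c x`. -/
noncomputable def lampAction (A X G : Type*) [AddCommGroup A] [Group G] [MulAction G X] :
    G →* MulAut (Lamps A X) where
  toFun g := AddEquiv.toMultiplicative (Finsupp.domCongr (MulAction.toPerm g : Equiv.Perm X))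
  map_one' := by
    ext c x
    simp
  map_mul' g h := by
    ext c x
    simp [mul_smul]

/-- The permutational wreath product `A ≀_X G = (⨁_X A) ⋊ G`. Elements are pairs `⟨c, p⟩`. -/
abbrev PermWreath (A X G : Type*) [AddCommGroup A] [Group G] [MulAction G X] : Type _ :=
  Lamps A X ⋊[lampAction A X G] G

section Aptolic

variable {A B X Y G H : Type*} [AddCommGroup A] [AddCommGroup B] [Group G] [Group H]
  [MulAction G X] [MulAction H Y]

/-- `q` has the form `q (c, p) = (α c, β p)`. -/
def IsAptolicForm (q : PermWreath A X G → PermWreath B Y H) : Prop :=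
  ∃ (α : Lamps A X → Lamps B Y) (β : G → H),
    ∀ (c : Lamps A X) (p : G), q ⟨c, p⟩ = ⟨α c, β p⟩

/-- `q` is an aptolic quasi-isometry: a quasi-isometry of aptolic form with a quasi-inverse of
aptolic form. -/
def IsAptolicQuasiIsometry
    (dX : PermWreath A X G → PermWreath A X G → ℕ)
    (dY : PermWreath B Y H → PermWreath B Y H → ℕ)
    (q : PermWreath A X G → PermWreath B Y H) : Prop :=
  IsQuasiIsometry dX dY q ∧ IsAptolicForm q ∧
  ∃ r : PermWreath B Y H → PermWreath A X G, IsQuasiInverse dX dY q r ∧ IsAptolicForm r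

end Aptolic

/-! A quasi-isometry of pairs induces a coarse equivalence `φ` between the quotient groups `G ⧸ M`
and `H ⧸ N`. Since `G ⧸ M` is non-amenable, finite sets expand in it by any prescribed factor, so
Hall's theorem and Schröder–Bernstein give, for all `a, b ≥ 1`, a bijection `(G ⧸ M) × Fin a ≃ (H ⧸
N) × Fin b` at bounded distance from `φ` (`IsCoarseInverse.exists_equiv_near`). As a set, `ZMod n`
is the product over the primes `p ∣ n` of `v_p(n)` copies of `ZMod p`. A colouring by `ZMod n` is
thus a family of `ZMod p`-colourings of `(G ⧸ M) × Fin (v_p n)`, which such a bijection with `a =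
v_p(n)`, `b = v_p(m)` transports to the other side; both exponents are positive exactly because `n`
and `m` have the same primes. The result is a bijection `α` of finitely supported colourings that
acts locally along `φ` (`exists_isLocalRecolouring`). Then `(c, g) ↦ (α c, f g)` and its analogue
for the inverses are coarse (`isCoarseMap_wreathMap`). Coarseness is phrased by finite sets of right
displacements, which makes sense in every group and refers to no generating set. -/

open scoped Pointwise symmDiff ENNReal

/-! ### Bounded word distance versus finite sets of displacements -/

section WordMetric

variable {G : Type*} [Group G] {S : Set G}

theorem IsFiniteGeneratingSet.connected (hS : IsFiniteGeneratingSet S) :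
    (SimpleGraph.mulCayley S).Connected := by
  have key : ∀ y : G, ∀ x : G, (SimpleGraph.mulCayley S).Reachable x (x * y) := by
    intro y
    have hy : y ∈ Subgroup.closure S := hS.2 ▸ Subgroup.mem_top y
    induction hy using Subgroup.closure_induction with
    | mem s hs =>
      intro x
      by_cases h : x = x * s
      · rw [← h]
      · exact SimpleGraph.Adj.reachable
          ((SimpleGraph.mulCayley_adj S _ _).2 ⟨h, Or.inl (by simpa using hs)⟩)
    | one => intro x; simp
    | mul a b _ _ iha ihb => intro x; rw [← mul_assoc]; exact (iha x).trans (ihb _)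
    | inv a _ iha => intro x; simpa using (iha (x * a⁻¹)).symm
  have : Nonempty G := ⟨1⟩
  exact ⟨fun x y => by simpa using key (x⁻¹ * y) x⟩

theorem IsFiniteGeneratingSet.wordDist_triangle (hS : IsFiniteGeneratingSet S) (x y z : G) :
    wordDist S x z ≤ wordDist S x y + wordDist S y z :=
  hS.connected.dist_triangle

theorem wordDist_comm (x y : G) : wordDist S x y = wordDist S y x :=
  SimpleGraph.dist_comm

/-- Word balls are powers of the symmetrised generating set. -/
theorem IsFiniteGeneratingSet.wordDist_le_iff (hS : IsFiniteGeneratingSet S) {n : ℕ} {x y : G} :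
    wordDist S x y ≤ n ↔ x⁻¹ * y ∈ (insert 1 (S ∪ S⁻¹)) ^ n := by
  constructor
  · intro h
    have walk : ∀ {u v : G} (w : (SimpleGraph.mulCayley S).Walk u v),
        u⁻¹ * v ∈ (insert 1 (S ∪ S⁻¹)) ^ w.length := by
      intro u v w
      induction w with
      | nil => simp
      | @cons u v w huv _ ih =>
        rw [SimpleGraph.Walk.length_cons, pow_succ']
        refine Set.mem_mul.2 ⟨u⁻¹ * v, ?_, _, ih, by group⟩
        rcases ((SimpleGraph.mulCayley_adj S _ _).1 huv).2 with h | h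
        · exact Or.inr (Or.inl h)
        · exact Or.inr (Or.inr (by simpa using h))
    obtain ⟨w, hw⟩ := hS.connected.exists_walk_length_eq_dist x y
    refine Set.pow_subset_pow_right (by simp) ?_ (walk w)
    rw [hw]; exact h
  · intro h
    induction n generalizing x with
    | zero =>
      have : x = y := inv_mul_eq_one.1 (by simpa using h)
      simp [this, wordDist]
    | succ n ih =>
      rw [pow_succ', Set.mem_mul] at h
      obtain ⟨e, he, r, hr, hxy⟩ := h
      have h1 : wordDist S x (x * e) ≤ 1 := by
        by_cases hne : x = x * e
        · rw [← hne]; simp [wordDist]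
        · refine (SimpleGraph.dist_eq_one_iff_adj.2
            ((SimpleGraph.mulCayley_adj S _ _).2 ⟨hne, ?_⟩)).le
          rcases he with rfl | he | he
          · simp at hne
          · exact Or.inl (by simpa using he)
          · exact Or.inr (by simpa using he)
      have h2 : wordDist S (x * e) y ≤ n := by
        refine ih ?_
        have : (x * e)⁻¹ * y = r := by
          rw [mul_inv_rev, mul_assoc, ← hxy]; group
        rwa [this]
      have := hS.wordDist_triangle x (x * e) y
      omega

theorem finite_pow {M : Type*} [Monoid M] {E : Set M} (hE : E.Finite) (n : ℕ) :
    (E ^ n).Finite := by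
  induction n with
  | zero => simp
  | succ n ih => rw [pow_succ]; exact ih.mul hE

theorem IsFiniteGeneratingSet.exists_finite_of_wordDist_le (hS : IsFiniteGeneratingSet S) (n : ℕ) :
    ∃ B : Set G, B.Finite ∧ ∀ x y : G, wordDist S x y ≤ n → x⁻¹ * y ∈ B :=
  ⟨_, finite_pow ((hS.1.union hS.1.inv).insert 1) n, fun _ _ h => hS.wordDist_le_iff.1 h⟩

theorem IsFiniteGeneratingSet.exists_wordDist_le (hS : IsFiniteGeneratingSet S) {B : Set G}
    (hB : B.Finite) : ∃ n : ℕ, ∀ x y : G, x⁻¹ * y ∈ B → wordDist S x y ≤ n := by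
  obtain ⟨n, hn⟩ := (hB.image (fun b => wordDist S 1 b)).bddAbove
  refine ⟨n, fun x y hxy => hS.wordDist_le_iff.2 ?_⟩
  have : wordDist S 1 (x⁻¹ * y) ≤ n := hn ⟨_, hxy, rfl⟩
  simpa using hS.wordDist_le_iff.1 this

end WordMetric

/-! ### Coarse equivalences of groups and quasi-isometries -/

section CoarseMaps

variable {G H : Type*} [Group G] [Group H]

/-- A coarse map between groups endowed with their left-invariant coarse structures. -/
def IsCoarseMap (f : G → H) : Prop :=
  ∀ A : Set G, A.Finite → ∃ B : Set H, B.Finite ∧ ∀ x, ∀ a ∈ A, (f x)⁻¹ * f (x * a) ∈ B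

/-- Two maps are close if they differ by a finite set of right translations. -/
def IsClose {X : Type*} (f g : X → H) : Prop :=
  ∃ B : Set H, B.Finite ∧ ∀ x, (f x)⁻¹ * g x ∈ B

/-- `f` and `r` are coarse maps inverse to each other up to closeness. -/
structure IsCoarseInverse (f : G → H) (r : H → G) : Prop where
  coarse : IsCoarseMap f
  coarse_inv : IsCoarseMap r
  left_close : IsClose (fun x => r (f x)) id
  right_close : IsClose (fun y => f (r y)) id

theorem IsCoarseInverse.symm {f : G → H} {r : H → G} (h : IsCoarseInverse f r) :
    IsCoarseInverse r f :=
  ⟨h.coarse_inv, h.coarse, h.right_close, h.left_close⟩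

variable {S : Set G} {T : Set H}

/-- Coarse maps are Lipschitz for word metrics. -/
theorem IsCoarseMap.exists_lipschitz {f : G → H} (hf : IsCoarseMap f)
    (hS : IsFiniteGeneratingSet S) (hT : IsFiniteGeneratingSet T) :
    ∃ C : ℕ, ∀ x y, wordDist T (f x) (f y) ≤ C * wordDist S x y := by
  obtain ⟨B, hB, hfB⟩ := hf (S ∪ S⁻¹) (hS.1.union hS.1.inv)
  obtain ⟨C, hC⟩ := hT.exists_wordDist_le hB
  refine ⟨C, fun x y => ?_⟩
  have walk : ∀ {u v : G} (w : (SimpleGraph.mulCayley S).Walk u v),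
      wordDist T (f u) (f v) ≤ C * w.length := by
    intro u v w
    induction w with
    | nil => simp [wordDist]
    | @cons u v w huv _ ih =>
      have h1 : wordDist T (f u) (f v) ≤ C := by
        refine hC _ _ ?_
        have := hfB u (u⁻¹ * v) ?_
        · simpa using this
        · rcases ((SimpleGraph.mulCayley_adj S _ _).1 huv).2 with h | h
          · exact Or.inl h
          · exact Or.inr (by simpa using h)
      have := hT.wordDist_triangle (f u) (f v) (f w)
      rw [SimpleGraph.Walk.length_cons, mul_add]
      omega
  obtain ⟨w, hw⟩ := hS.connected.exists_walk_length_eq_dist x y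
  unfold wordDist at walk ⊢
  rw [← hw]
  exact walk w

theorem IsCoarseInverse.isQuasiIsometry {f : G → H} {r : H → G} (h : IsCoarseInverse f r)
    (hS : IsFiniteGeneratingSet S) (hT : IsFiniteGeneratingSet T) :
    IsQuasiIsometry (wordDist S) (wordDist T) f := by
  obtain ⟨C, hC⟩ := h.coarse.exists_lipschitz hS hT
  obtain ⟨C', hC'⟩ := h.coarse_inv.exists_lipschitz hT hS
  obtain ⟨B, hB, hrf⟩ := h.left_close
  obtain ⟨D, hD⟩ := hS.exists_wordDist_le hB
  obtain ⟨B', hB', hfr⟩ := h.right_close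
  obtain ⟨D', hD'⟩ := hT.exists_wordDist_le hB'
  have hpos : (0 : ℝ) < 1 + C + C' := by positivity
  -- The summand `1` secures the bound `1 ≤ C` asked of the constant; `2 * D` pays for moving both
  -- `x` and `y` to their images under `r ∘ f`, and `D'` for coarse surjectivity.
  refine ⟨1 + C + C', 2 * D + D', by linarith [C.cast_nonneg (α := ℝ), C'.cast_nonneg (α := ℝ)],
    by positivity, fun x y => ⟨?_, ?_⟩, fun y => ⟨r y, ?_⟩⟩
  · have h1 := hD _ _ (hrf x)
    have h2 := hD _ _ (hrf y)
    have h3 := hS.wordDist_triangle x (r (f x)) y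
    have h4 := hS.wordDist_triangle (r (f x)) (r (f y)) y
    rw [wordDist_comm x (r (f x))] at h3
    have h5 := hC' (f x) (f y)
    simp only [id] at h1 h2
    have h6 : wordDist S x y ≤ 2 * D + C' * wordDist T (f x) (f y) := by omega
    have h7 : (wordDist S x y : ℝ) ≤ 2 * D + C' * wordDist T (f x) (f y) := by exact_mod_cast h6
    rw [sub_le_iff_le_add, one_div, inv_mul_le_iff₀ hpos]
    have e1 : (0 : ℝ) ≤ wordDist T (f x) (f y) := Nat.cast_nonneg _
    have e2 : (0 : ℝ) ≤ C := Nat.cast_nonneg _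
    have e3 : (0 : ℝ) ≤ C' := Nat.cast_nonneg _
    have e4 : (0 : ℝ) ≤ D := Nat.cast_nonneg _
    have e5 : (0 : ℝ) ≤ D' := Nat.cast_nonneg _
    nlinarith [mul_nonneg e2 e1, mul_nonneg e2 e4, mul_nonneg e2 e5, mul_nonneg e3 e4,
      mul_nonneg e3 e5]
  · have h1 : (wordDist T (f x) (f y) : ℝ) ≤ C * wordDist S x y := by exact_mod_cast hC x y
    have e1 : (0 : ℝ) ≤ wordDist S x y := Nat.cast_nonneg _
    have e3 : (0 : ℝ) ≤ C' := Nat.cast_nonneg _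
    have e4 : (0 : ℝ) ≤ D := Nat.cast_nonneg _
    have e5 : (0 : ℝ) ≤ D' := Nat.cast_nonneg _
    nlinarith [mul_nonneg e3 e1]
  · have h1 := hD' _ _ (hfr y)
    rw [wordDist_comm] at h1
    have h2 : (wordDist T y (f (r y)) : ℝ) ≤ D' := by exact_mod_cast h1
    have e4 : (0 : ℝ) ≤ D := Nat.cast_nonneg _
    linarith

theorem IsCoarseInverse.isQuasiInverse {f : G → H} {r : H → G} (h : IsCoarseInverse f r)
    (hS : IsFiniteGeneratingSet S) (hT : IsFiniteGeneratingSet T) :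
    IsQuasiInverse (wordDist S) (wordDist T) f r := by
  obtain ⟨B, hB, hrf⟩ := h.left_close
  obtain ⟨D, hD⟩ := hS.exists_wordDist_le hB
  obtain ⟨B', hB', hfr⟩ := h.right_close
  obtain ⟨D', hD'⟩ := hT.exists_wordDist_le hB'
  exact ⟨h.symm.isQuasiIsometry hT hS, max D D',
    fun x => (hD _ _ (hrf x)).trans (le_max_left _ _),
    fun y => (hD' _ _ (hfr y)).trans (le_max_right _ _)⟩

/-- A quasi-isometry between finitely generated groups has a coarse inverse. -/
theorem IsQuasiIsometry.exists_isCoarseInverse {f : G → H}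
    (hS : IsFiniteGeneratingSet S) (hT : IsFiniteGeneratingSet T)
    (hf : IsQuasiIsometry (wordDist S) (wordDist T) f) : ∃ r : H → G, IsCoarseInverse f r := by
  obtain ⟨C, K, hC, hK, hCK, hsurj⟩ := hf
  have hC0 : 0 < C := by linarith
  choose r hr using hsurj
  have lower : ∀ x x', (wordDist S x x' : ℝ) ≤ C * (wordDist T (f x) (f x') + K) := by
    intro x x'
    have := (hCK x x').1
    rwa [sub_le_iff_le_add, one_div, inv_mul_le_iff₀ hC0] at this
  refine ⟨r, ?_, ?_, ?_, ?_⟩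
  · intro A hA
    obtain ⟨n, hn⟩ := hS.exists_wordDist_le hA
    obtain ⟨B, hB, h⟩ := hT.exists_finite_of_wordDist_le ⌊C * n + K⌋₊
    refine ⟨B, hB, fun x a ha => h _ _ (Nat.le_floor ((hCK _ _).2.trans ?_))⟩
    have : (wordDist S x (x * a) : ℝ) ≤ n := by exact_mod_cast hn _ _ (by simpa using ha)
    gcongr
  · intro A hA
    obtain ⟨n, hn⟩ := hT.exists_wordDist_le hA
    obtain ⟨B, hB, h⟩ := hS.exists_finite_of_wordDist_le ⌊C * (K + n + K + K)⌋₊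
    refine ⟨B, hB, fun x a ha => h _ _ (Nat.le_floor ((lower _ _).trans ?_))⟩
    have h1 : (wordDist T x (x * a) : ℝ) ≤ n := by exact_mod_cast hn _ _ (by simpa using ha)
    have h2 := hr x
    rw [wordDist_comm] at h2
    have h3 := hr (x * a)
    have h4 : (wordDist T (f (r x)) (f (r (x * a))) : ℝ) ≤
        wordDist T (f (r x)) x + (wordDist T x (x * a) + wordDist T (x * a) (f (r (x * a)))) := by
      exact_mod_cast (hT.wordDist_triangle _ x _).trans
        (Nat.add_le_add_left (hT.wordDist_triangle _ (x * a) _) _)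
    gcongr
    linarith
  · obtain ⟨B, hB, h⟩ := hS.exists_finite_of_wordDist_le ⌊C * (K + K)⌋₊
    refine ⟨B, hB, fun x => h _ _ (Nat.le_floor ((lower _ _).trans ?_))⟩
    have := hr (f x)
    rw [wordDist_comm] at this
    simp only [id]
    gcongr
  · obtain ⟨B, hB, h⟩ := hT.exists_finite_of_wordDist_le ⌊K⌋₊
    refine ⟨B, hB, fun y => h _ _ (Nat.le_floor ?_)⟩
    rw [wordDist_comm]
    exact hr y

end CoarseMaps

/-! ### Følner sets and expansion in non-amenable groups -/

section Amenability

open MeasureTheory Filter Topology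

variable {Γ : Type*} [Group Γ]

/-- A group with Følner sets for all finite sets of translations has an invariant mean. -/
theorem isAmenableAction_of_foelner [DecidableEq Γ]
    (h : ∀ (A : Finset Γ) (k : ℕ), ∃ F : Finset Γ, F.Nonempty ∧
      ∀ a ∈ A, (k + 1) * ((F * {a}) \ F).card ≤ F.card) :
    IsAmenableAction Γ Γ := by
  choose F hne hF using h
  let _ : MeasurableSpace Γ := ⊤
  have : DiscreteMeasurableSpace Γ := ⟨fun _ => trivial⟩
  have hinv : SMulInvariantMeasure Γ Γ (Measure.count : Measure Γ) := by
    refine ⟨fun c s _ => ?_⟩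
    rw [← Measure.count_injective_image (f := fun x : Γ => c • x) (MulAction.injective c),
      Set.image_preimage_eq _ (MulAction.surjective c)]
  -- The sets `F` are almost invariant on the right and the mean must be invariant on the left,
  -- hence the inverses: left translation of `F⁻¹` by `g` corresponds to right translation of `F` by
  -- `g⁻¹`.
  have hfoel : IsFoelner Γ (Measure.count : Measure Γ) (atTop : Filter (Finset Γ × ℕ))
      (fun i => (((F i.1 i.2)⁻¹ : Finset Γ) : Set Γ)) := by
    refine ⟨Eventually.of_forall fun _ => trivial, Eventually.of_forall fun i => ?_,
      Eventually.of_forall fun i => ?_, fun g => ?_⟩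
    · rw [Measure.count_apply_finset]
      simpa using (hne i.1 i.2).ne_empty
    · rw [Measure.count_apply_finset]
      exact ENNReal.natCast_ne_top _
    · have hlim : Tendsto (fun i : Finset Γ × ℕ => (2 : ℝ≥0∞) * ((i.2 : ℝ≥0∞))⁻¹) atTop (𝓝 0) := by
        have h1 : Tendsto (fun i : Finset Γ × ℕ => ((i.2 : ℝ≥0∞))⁻¹) atTop (𝓝 0) :=
          ENNReal.tendsto_inv_nat_nhds_zero.comp
            ((tendsto_snd (f := (atTop : Filter (Finset Γ)))).mono_left prod_atTop_atTop_eq.ge)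
        simpa using ENNReal.Tendsto.const_mul h1 (Or.inr (by simp))
      refine tendsto_of_tendsto_of_tendsto_of_le_of_le' tendsto_const_nhds hlim
        (Eventually.of_forall fun _ => zero_le) ?_
      filter_upwards [eventually_ge_atTop (({g⁻¹} : Finset Γ), 1)] with i hi
      have hg : g⁻¹ ∈ i.1 := hi.1 (by simp)
      set E := F i.1 i.2
      have hE := hF i.1 i.2 _ hg
      have hcard : ((E * {g⁻¹}) \ E).card = (E \ (E * {g⁻¹})).card := by
        refine Finset.card_sdiff_comm ?_
        simp [Finset.mul_singleton]
      have hset : (g • ((E⁻¹ : Finset Γ) : Set Γ)) ∆ ((E⁻¹ : Finset Γ) : Set Γ) =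
          ((((E * {g⁻¹}) \ E) ∪ (E \ (E * {g⁻¹})))⁻¹ : Finset Γ) := by
        ext x
        simp [Set.mem_symmDiff, Set.mem_smul_set_iff_inv_smul_mem, Finset.mul_singleton]
      rw [hset, Measure.count_apply_finset, Measure.count_apply_finset, Finset.card_inv,
        Finset.card_inv]
      have hle : (((E * {g⁻¹}) \ E) ∪ (E \ (E * {g⁻¹}))).card * i.2 ≤ 2 * E.card := by
        have := Finset.card_union_le ((E * {g⁻¹}) \ E) (E \ (E * {g⁻¹}))
        nlinarith
      have hE0 : (E.card : ℝ≥0∞) ≠ 0 := by simpa using (hne i.1 i.2).ne_empty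
      have hi0 : (i.2 : ℝ≥0∞) ≠ 0 := by
        have : 1 ≤ i.2 := hi.2
        simp; omega
      rw [ENNReal.div_le_iff hE0 (ENNReal.natCast_ne_top _), mul_right_comm, ← div_eq_mul_inv,
        ENNReal.le_div_iff_mul_le (Or.inl hi0) (Or.inl (ENNReal.natCast_ne_top _))]
      exact_mod_cast hle
  obtain ⟨μ, h1, hadd, hmul⟩ := hfoel.amenable
  have hfin : ∀ A, μ A ≠ ∞ := by
    intro A hA
    have := hadd A Aᶜ trivial disjoint_compl_right
    rw [Set.union_compl_self, h1, hA] at this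
    simp at this
  refine ⟨fun A => (μ A).toReal, fun _ => ENNReal.toReal_nonneg, by simp [h1], fun A B hAB => ?_,
    fun g A => congrArg ENNReal.toReal (hmul g A)⟩
  simp only [hadd A B trivial hAB]
  rw [ENNReal.toReal_add (hfin A) (hfin B)]

/-- In a non-amenable group, finite sets are expanded by right multiplication by a fixed finite
set, as much as wanted. -/
theorem exists_expanding_of_not_isAmenableAction [DecidableEq Γ] (hΓ : ¬ IsAmenableAction Γ Γ)
    (k : ℕ) : ∃ A : Finset Γ, ∀ F : Finset Γ, k * F.card ≤ (F * A).card := by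
  have iterate : ∀ (a b : ℕ) (A : Finset Γ), (∀ F : Finset Γ, a * F.card ≤ b * (F * A).card) →
      ∀ (j : ℕ) (F : Finset Γ), a ^ j * F.card ≤ b ^ j * (F * A ^ j).card := by
    intro a b A hA j
    induction j with
    | zero => simp
    | succ j ih =>
      intro F
      have h1 := ih F
      have h2 := hA (F * A ^ j)
      rw [pow_succ A, ← mul_assoc F]
      calc a ^ (j + 1) * F.card = a * (a ^ j * F.card) := by ring
        _ ≤ a * (b ^ j * (F * A ^ j).card) := by gcongr
        _ = b ^ j * (a * (F * A ^ j).card) := by ring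
        _ ≤ b ^ j * (b * (F * A ^ j * A).card) := by gcongr
        _ = b ^ (j + 1) * (F * A ^ j * A).card := by ring
  have hdouble : ∃ A : Finset Γ, ∀ F : Finset Γ, 2 * F.card ≤ (F * A).card := by
    by_contra! hcon
    refine hΓ (isAmenableAction_of_foelner fun A k => ?_)
    -- Otherwise every set grows by the factor `(k + 2) / (k + 1)`; after `k + 1` iterations
    -- Bernoulli's inequality gives doubling, against `hcon`. Inserting `1` makes `F` a subset of
    -- its product, so small growth means small boundary.
    have : ∃ F : Finset Γ, (k + 1) * (F * insert 1 A).card < (k + 2) * F.card := by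
      by_contra! hk
      obtain ⟨F, hF⟩ := hcon (insert 1 A ^ (k + 1))
      have h1 := iterate _ _ _ hk (k + 1) F
      have h2 : 2 * (k + 1) ^ (k + 1) ≤ (k + 2) ^ (k + 1) := by
        have := pow_add_mul_le_add_pow (R := ℕ) (a := k + 1) (b := 1) (by simp) (by simp) (k + 1)
        rw [Nat.add_sub_cancel, Nat.cast_id, mul_one, add_assoc k 1 1] at this
        have h : (k + 1) * (k + 1) ^ k = (k + 1) ^ (k + 1) := by ring
        rw [h] at this
        exact (two_mul _).le.trans this
      have h3 : 0 < (k + 1) ^ (k + 1) := by positivity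
      nlinarith
    obtain ⟨F, hF⟩ := this
    refine ⟨F, ?_, fun a ha => ?_⟩
    · rw [Finset.nonempty_iff_ne_empty]
      rintro rfl
      simp at hF
    · have hsub : (F * {a}) \ F ⊆ (F * insert 1 A) \ F := by
        gcongr
        simp [ha]
      have hFsub : F ⊆ F * insert 1 A := fun x hx =>
        Finset.mem_mul.2 ⟨x, hx, 1, by simp, by simp⟩
      have h1 := Finset.card_le_card hsub
      have h2 := Finset.card_sdiff_add_card_eq_card hFsub
      nlinarith
  obtain ⟨A, hA⟩ := hdouble
  refine ⟨A ^ k, fun F => ?_⟩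
  have := iterate 2 1 A (by simpa using hA) k F
  rw [one_pow, one_mul] at this
  exact le_trans (Nat.mul_le_mul_right _ Nat.lt_two_pow_self.le) this

end Amenability

/-! ### Composition, transposition and fibres of coarse maps -/

section CoarseCalculus

variable {X : Type*} {G H : Type*} [Group G] [Group H]

theorem IsClose.trans {f g k : X → H} (h : IsClose f g) (h' : IsClose g k) : IsClose f k := by
  obtain ⟨B, hB, hfg⟩ := h
  obtain ⟨B', hB', hgk⟩ := h'
  refine ⟨B * B', hB.mul hB', fun x => ?_⟩
  simpa [mul_assoc] using Set.mul_mem_mul (hfg x) (hgk x)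

theorem IsClose.map {f g : X → G} (h : IsClose f g) (φ : G →* H) :
    IsClose (fun x => φ (f x)) (fun x => φ (g x)) := by
  obtain ⟨B, hB, hfg⟩ := h
  exact ⟨φ '' B, hB.image _, fun x => ⟨_, hfg x, by simp⟩⟩

theorem IsCoarseMap.comp_isClose {φ : G → H} (hφ : IsCoarseMap φ) {f g : X → G}
    (h : IsClose f g) : IsClose (fun x => φ (f x)) (fun x => φ (g x)) := by
  obtain ⟨B, hB, hfg⟩ := h
  obtain ⟨B', hB', hφB⟩ := hφ B hB
  exact ⟨B', hB', fun x => by simpa using hφB (f x) _ (hfg x)⟩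

/-- Apply `ψ` to the pair `φ x`, `y` and use that `ψ (φ x)` is close to `x`. This trades
displacement bounds along `φ` for bounds along `ψ`. -/
theorem IsCoarseInverse.exists_transpose {φ : G → H} {ψ : H → G} (h : IsCoarseInverse φ ψ)
    {C : Set H} (hC : C.Finite) :
    ∃ C' : Set G, C'.Finite ∧ ∀ x y, (φ x)⁻¹ * y ∈ C → (ψ y)⁻¹ * x ∈ C' := by
  obtain ⟨B, hB, hψ⟩ := h.coarse_inv C hC
  obtain ⟨B', hB', hcl⟩ := h.left_close
  refine ⟨B⁻¹ * B', hB.inv.mul hB', fun x y hxy => ?_⟩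
  have h1 := hψ (φ x) _ hxy
  have h2 := hcl x
  simpa [mul_assoc] using Set.mul_mem_mul (Set.inv_mem_inv.2 h1) h2

/-- The fibre of `φ` over `y` lies in a translate by `ψ y` of a fixed finite set. -/
theorem IsCoarseInverse.exists_card_le_mul_card_image [DecidableEq H] {φ : G → H} {ψ : H → G}
    (h : IsCoarseInverse φ ψ) :
    ∃ κ : ℕ, 0 < κ ∧ ∀ F : Finset G, F.card ≤ κ * (F.image φ).card := by
  classical
  obtain ⟨C, hC, hφψ⟩ := h.exists_transpose (Set.finite_singleton 1)
  refine ⟨hC.toFinset.card + 1, by omega, fun F =>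
    Finset.card_le_mul_card_image _ _ fun y _ => ?_⟩
  refine le_trans (Finset.card_le_card_of_injOn (fun x => (ψ y)⁻¹ * x) ?_
    (mul_right_injective _).injOn) (Nat.le_succ _)
  intro x hx
  simp only [Finset.coe_filter, Set.mem_ofPred_eq] at hx
  simpa using hφψ x y (by simp [hx.2])

end CoarseCalculus

/-! ### Bijections near a coarse equivalence -/

section Matching

variable {Y : Type*} [Group Y]

/-- Hall's marriage theorem, for displacements lying in a finite set. -/
theorem exists_injective_near {X : Type*} [DecidableEq Y] (φ : X → Y) {a b : ℕ} (hb : 0 < b)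
    (B : Finset Y)
    (hB : ∀ F : Finset X, a * F.card ≤ (F.image φ * B).card) :
    ∃ j : X × Fin a → Y × Fin b, Function.Injective j ∧ ∀ z, (φ z.1)⁻¹ * (j z).1 ∈ B := by
  classical
  -- Neighbours depend only on the first coordinate, so expansion by `a` makes room for the `a`
  -- copies of each point.
  have hall : ∀ s : Finset (X × Fin a), s.card ≤ (s.biUnion
      (fun z => (φ z.1 • B) ×ˢ (Finset.univ : Finset (Fin b)))).card := by
    intro s
    have h1 : s.card ≤ a * (s.image Prod.fst).card := by
      have : s ⊆ s.image Prod.fst ×ˢ (Finset.univ : Finset (Fin a)) := fun z hz =>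
        Finset.mem_product.2 ⟨Finset.mem_image_of_mem _ hz, Finset.mem_univ _⟩
      simpa [mul_comm] using Finset.card_le_card this
    have h2 : ((s.image Prod.fst).image φ * B) ×ˢ (Finset.univ : Finset (Fin b)) ⊆
        s.biUnion (fun z => (φ z.1 • B) ×ˢ (Finset.univ : Finset (Fin b))) := by
      rintro ⟨y, j⟩ hy
      obtain ⟨y', hy', e, he, rfl⟩ := Finset.mem_mul.1 (Finset.mem_product.1 hy).1
      obtain ⟨x, hx, rfl⟩ := Finset.mem_image.1 hy'
      obtain ⟨z, hz, rfl⟩ := Finset.mem_image.1 hx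
      exact Finset.mem_biUnion.2 ⟨z, hz, Finset.mem_product.2
        ⟨Finset.smul_mem_smul_finset he, Finset.mem_univ _⟩⟩
    have h3 := Finset.card_le_card h2
    rw [Finset.card_product, Finset.card_univ, Fintype.card_fin] at h3
    exact h1.trans ((hB _).trans ((Nat.le_mul_of_pos_right _ hb).trans h3))
  obtain ⟨j, hj, hjB⟩ := (Finset.all_card_le_biUnion_card_iff_exists_injective _).1 hall
  refine ⟨j, hj, fun z => ?_⟩
  obtain ⟨e, he, hez⟩ := Finset.mem_smul_finset.1 (Finset.mem_product.1 (hjB z)).1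
  rw [← hez]
  simpa using he

/-- A coarse equivalence out of a non-amenable group is close to a bijection after replacing
points of the source by `a` copies and points of the target by `b` copies. -/
theorem IsCoarseInverse.exists_equiv_near {X : Type*} [Group X] {φ : X → Y} {ψ : Y → X}
    (h : IsCoarseInverse φ ψ) (hX : ¬ IsAmenableAction X X) {a b : ℕ} (ha : 0 < a) (hb : 0 < b) :
    ∃ (C : Set Y) (σ : X × Fin a ≃ Y × Fin b), C.Finite ∧
      ∀ z, (φ z.1)⁻¹ * (σ z).1 ∈ C := by
  classical
  obtain ⟨κ, hκ, hφκ⟩ := h.exists_card_le_mul_card_image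
  obtain ⟨κ', -, hψκ⟩ := h.symm.exists_card_le_mul_card_image
  -- Both expansions take place in `X`. The factors `κ` and `κ'` compensate for the non-injectivity
  -- of `φ` and `ψ`.
  obtain ⟨A, hA⟩ := exists_expanding_of_not_isAmenableAction hX (κ * a)
  obtain ⟨A', hA'⟩ := exists_expanding_of_not_isAmenableAction hX (b * κ')
  obtain ⟨B, hB, hφB⟩ := h.coarse A A.finite_toSet
  obtain ⟨j, hj, hjB⟩ := exists_injective_near φ (a := a) hb hB.toFinset (fun F => by
    have h1 : (F * A).image φ ⊆ F.image φ * hB.toFinset := by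
      intro y hy
      obtain ⟨x, hx, rfl⟩ := Finset.mem_image.1 hy
      obtain ⟨g, hg, e, he, rfl⟩ := Finset.mem_mul.1 hx
      exact Finset.mem_mul.2 ⟨φ g, Finset.mem_image_of_mem _ hg, _,
        hB.mem_toFinset.2 (hφB g e he), by simp⟩
    refine Nat.le_of_mul_le_mul_left ?_ hκ
    rw [← mul_assoc]
    exact (hA F).trans ((hφκ _).trans (Nat.mul_le_mul_left _ (Finset.card_le_card h1))))
  obtain ⟨k, hk, hkA⟩ := exists_injective_near ψ (a := b) ha A' (fun F => by
    refine le_trans ?_ (hA' (F.image ψ))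
    rw [mul_assoc]
    exact Nat.mul_le_mul_left _ (hψκ F))
  obtain ⟨C, hC, hAC⟩ := h.symm.exists_transpose A'.finite_toSet
  -- At each point the bijection follows either `j` or the inverse of `k`, so its displacement lies
  -- in `B ∪ C`.
  obtain ⟨σ, hσ, hσC⟩ := Function.Embedding.schroeder_bernstein_of_rel hj hk
    (fun z w => (φ z.1)⁻¹ * w.1 ∈ B ∪ C)
    (fun z => Or.inl (hB.mem_toFinset.1 (hjB z))) (fun w => Or.inr (hAC _ _ (hkA w)))
  exact ⟨B ∪ C, Equiv.ofBijective σ hσ, hB.union hC, hσC⟩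

end Matching

/-! ### Local bijections between colourings -/

section Recolouring

variable {ι : Type*} {Z : ι → Type*} {a b : ι → ℕ} {A B X Y : Type*}

/-- Regard an `A`-colouring of `X` as a family of `Z p`-colourings of `X × Fin (a p)`, transport
it to `Y × Fin (b p)`, and regard the result as a `B`-colouring of `Y`. -/
def recolour (eA : A ≃ ∀ p, Fin (a p) → Z p) (eB : B ≃ ∀ p, Fin (b p) → Z p)
    (σ : ∀ p, X × Fin (a p) ≃ Y × Fin (b p)) (c : X → A) (y : Y) : B :=
  eB.symm fun p j => eA (c ((σ p).symm (y, j)).1) p ((σ p).symm (y, j)).2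

theorem recolour_recolour (eA : A ≃ ∀ p, Fin (a p) → Z p) (eB : B ≃ ∀ p, Fin (b p) → Z p)
    (σ : ∀ p, X × Fin (a p) ≃ Y × Fin (b p)) (c : X → A) :
    recolour eB eA (fun p => (σ p).symm) (recolour eA eB σ c) = c := by
  funext x
  simp [recolour]

theorem exists_ne_of_recolour_ne (eA : A ≃ ∀ p, Fin (a p) → Z p)
    (eB : B ≃ ∀ p, Fin (b p) → Z p) (σ : ∀ p, X × Fin (a p) ≃ Y × Fin (b p)) {c c' : X → A} {y : Y}
    (h : recolour eA eB σ c y ≠ recolour eA eB σ c' y) :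
    ∃ p j, c ((σ p).symm (y, j)).1 ≠ c' ((σ p).symm (y, j)).1 := by
  by_contra! hcon
  exact h (by simp [recolour, hcon])

theorem recolour_zero [AddCommGroup A] [AddCommGroup B] [∀ p, Zero (Z p)]
    (eA : A ≃ ∀ p, Fin (a p) → Z p) (eB : B ≃ ∀ p, Fin (b p) → Z p)
    (hA : eA 0 = 0) (hB : eB 0 = 0) (σ : ∀ p, X × Fin (a p) ≃ Y × Fin (b p)) :
    recolour eA eB σ 0 = 0 := by
  funext y
  refine (Equiv.symm_apply_eq _).2 ?_
  rw [Pi.zero_apply, hB]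
  funext p j
  simp [hA]

/-- The residues modulo `n` are counted by the prime factorisation of `n`. -/
theorem exists_zmod_equiv {n : ℕ} (hn : n ≠ 0) {P : Finset ℕ} (hP : n.primeFactors = P) :
    ∃ e : ZMod n ≃ ∀ p : P, Fin (n.factorization p) → ZMod p, e 0 = 0 := by
  classical
  subst hP
  have : NeZero n := ⟨hn⟩
  have (p : n.primeFactors) : NeZero (p : ℕ) := ⟨(Nat.prime_of_mem_primeFactors p.2).ne_zero⟩
  have hcard : Nat.card (ZMod n) =
      Nat.card (∀ p : n.primeFactors, Fin (n.factorization p) → ZMod p) := by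
    simp only [Nat.card_pi, Nat.card_zmod, Finset.prod_const, Finset.card_univ, Fintype.card_fin]
    rw [Finset.prod_coe_sort n.primeFactors (fun p => p ^ n.factorization p)]
    exact (Nat.prod_factorization_pow_eq_self hn).symm
  obtain ⟨e⟩ := (Finite.card_eq (α := ZMod n)).1 hcard
  -- Any bijection of sets will do, provided that it fixes the zero colour: this is what preserves
  -- finite supports.
  exact ⟨e.trans (Equiv.swap (e 0) 0), by simp⟩

/-- A pointwise-local transformation of finitely supported colourings. -/
def IsLocalRecolouring [Group Y] [Zero A] [Zero B] (φ : X → Y)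
    (α : (X →₀ A) → (Y →₀ B)) : Prop :=
  ∃ C : Set Y, C.Finite ∧ ∀ c c' y, α c y ≠ α c' y → ∃ x, c x ≠ c' x ∧ (φ x)⁻¹ * y ∈ C

/-- Comparing `c` with the zero colouring confines the new support to `φ (supp c) * C`. -/
theorem finite_support_of_local [Group Y] [Zero A] [Zero B] {φ : X → Y} {C : Set Y} (hC : C.Finite)
    {R : (X → A) → Y → B} (h0 : R 0 = 0)
    (hR : ∀ c c' y, R c y ≠ R c' y → ∃ x, c x ≠ c' x ∧ (φ x)⁻¹ * y ∈ C) (c : X →₀ A) :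
    (Function.support (R c)).Finite := by
  refine ((c.support.finite_toSet.image φ).mul hC).subset fun y hy => ?_
  obtain ⟨x, hx, hxy⟩ := hR c 0 y (by simpa [h0] using hy)
  exact Set.mem_mul.2 ⟨φ x, ⟨x, by simpa using hx, rfl⟩, _, hxy, by simp⟩

/-- The new colour at `y` reads `c` only at first coordinates of the points `(σ p).symm (y, j)`,
whose images under `φ` are near `y`, uniformly because there are finitely many `p`. -/
theorem exists_isLocalRecolouring_of_equiv [Finite ι] [∀ p, Zero (Z p)] [AddCommGroup A]
    [AddCommGroup B] [Group X] [Group Y] {φ : X → Y} {ψ : Y → X} (h : IsCoarseInverse φ ψ)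
    (eA : A ≃ ∀ p, Fin (a p) → Z p) (eB : B ≃ ∀ p, Fin (b p) → Z p)
    (hA : eA 0 = 0) (hB : eB 0 = 0) (σ : ∀ p, X × Fin (a p) ≃ Y × Fin (b p))
    (hσ : ∀ p, ∃ C : Set Y, C.Finite ∧ ∀ z, (φ z.1)⁻¹ * (σ p z).1 ∈ C) :
    ∃ (α : (X →₀ A) → (Y →₀ B)) (α' : (Y →₀ B) → (X →₀ A)),
      IsLocalRecolouring φ α ∧ IsLocalRecolouring ψ α' ∧ (∀ c, α' (α c) = c) ∧
      ∀ d, α (α' d) = d := by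
  choose D hD hσD using hσ
  set C := ⋃ p, D p
  have hC : C.Finite := Set.finite_iUnion hD
  obtain ⟨C', hC', hCC'⟩ := h.exists_transpose hC
  have hloc : ∀ c c' y, recolour eA eB σ c y ≠ recolour eA eB σ c' y →
      ∃ x, c x ≠ c' x ∧ (φ x)⁻¹ * y ∈ C := by
    intro c c' y hy
    obtain ⟨p, j, hpj⟩ := exists_ne_of_recolour_ne eA eB σ hy
    exact ⟨_, hpj, Set.mem_iUnion.2 ⟨p, by simpa using hσD p ((σ p).symm (y, j))⟩⟩
  have hloc' : ∀ d d' x, recolour eB eA (fun p => (σ p).symm) d x ≠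
      recolour eB eA (fun p => (σ p).symm) d' x → ∃ y, d y ≠ d' y ∧ (ψ y)⁻¹ * x ∈ C' := by
    intro d d' x hx
    obtain ⟨p, j, hpj⟩ := exists_ne_of_recolour_ne eB eA (fun p => (σ p).symm) hx
    exact ⟨_, hpj, hCC' _ _ (Set.mem_iUnion.2 ⟨p, by simpa using hσD p (x, j)⟩)⟩
  refine ⟨fun c => Finsupp.ofSupportFinite (recolour _ _ _ _)
      (finite_support_of_local hC (recolour_zero eA eB hA hB σ) hloc c),
    fun d => Finsupp.ofSupportFinite (recolour _ _ _ _)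
      (finite_support_of_local hC' (recolour_zero eB eA hB hA fun p => (σ p).symm) hloc' d),
    ⟨C, hC, fun c c' y hy => hloc c c' y hy⟩, ⟨C', hC', fun d d' x hx => hloc' d d' x hx⟩,
    fun c => ?_, fun d => ?_⟩
  · exact DFunLike.coe_injective (recolour_recolour eA eB σ c)
  · exact DFunLike.coe_injective (recolour_recolour eB eA (fun p => (σ p).symm) d)

/-- If `n` and `m` have the same prime divisors, then `ZMod n`-colourings and `ZMod m`-colourings
of coarsely equivalent non-amenable groups correspond to each other locally. -/
theorem exists_isLocalRecolouring [Group X] [Group Y] {φ : X → Y} {ψ : Y → X}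
    (h : IsCoarseInverse φ ψ) (hX : ¬ IsAmenableAction X X) {n m : ℕ} (hn : n ≠ 0) (hm : m ≠ 0)
    (hnm : n.primeFactors = m.primeFactors) :
    ∃ (α : (X →₀ ZMod n) → (Y →₀ ZMod m)) (α' : (Y →₀ ZMod m) → (X →₀ ZMod n)),
      IsLocalRecolouring φ α ∧ IsLocalRecolouring ψ α' ∧ (∀ c, α' (α c) = c) ∧
      ∀ d, α (α' d) = d := by
  obtain ⟨eA, hA⟩ := exists_zmod_equiv hn rfl
  obtain ⟨eB, hB⟩ := exists_zmod_equiv hm hnm.symm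
  have hpos : ∀ k : ℕ, ∀ p ∈ k.primeFactors, 0 < k.factorization p := fun k p hp =>
    Nat.pos_of_ne_zero (Finsupp.mem_support_iff.1 (by simpa using hp))
  have key : ∀ p : n.primeFactors, ∃ (C : Set Y)
      (σ : X × Fin (n.factorization p) ≃ Y × Fin (m.factorization p)), C.Finite ∧
      ∀ z, (φ z.1)⁻¹ * (σ z).1 ∈ C := fun p =>
    h.exists_equiv_near hX (hpos n p p.2) (hpos m p (hnm ▸ p.2))
  choose C σ hC hσ using key
  exact exists_isLocalRecolouring_of_equiv h eA eB hA hB σ fun p => ⟨C p, hC p, hσ p⟩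

end Recolouring

/-! ### Passage to the quotient groups -/

section Quotients

variable {G H : Type*} [Group G] [Group H] {M : Subgroup G} {N : Subgroup H}

variable (M N) in
/-- `f` sends every coset of `M` uniformly close to a single coset of `N`. -/
def CoarselyDescends [N.Normal] (f : G → H) : Prop :=
  ∃ B : Set (H ⧸ N), B.Finite ∧
    ∀ g g' : G, (g : G ⧸ M) = g' → (f g : H ⧸ N)⁻¹ * (f g' : H ⧸ N) ∈ B

variable (M N) in
/-- The map induced between quotient groups, through a choice of representatives. -/
noncomputable def quotientMap (f : G → H) (x : G ⧸ M) : H ⧸ N :=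
  (f x.out : H ⧸ N)

theorem CoarselyDescends.isClose [N.Normal] {f : G → H} (hf : CoarselyDescends M N f) :
    IsClose (fun g : G => quotientMap M N f g) (fun g => (f g : H ⧸ N)) := by
  obtain ⟨B, hB, h⟩ := hf
  exact ⟨B, hB, fun g => h _ _ (by simp)⟩

/-- The chosen representative of `x * a` and the product of those of `x` and `a` lie in one coset;
coarseness of `f` handles the product. -/
theorem CoarselyDescends.isCoarseMap [M.Normal] [N.Normal] {f : G → H} (hf : CoarselyDescends M N f)
    (hc : IsCoarseMap f) : IsCoarseMap (quotientMap M N f) := by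
  intro A hA
  obtain ⟨B, hB, h⟩ := hf
  obtain ⟨B', hB', hfB⟩ := hc (Quotient.out '' A) (hA.image _)
  refine ⟨((↑) : H → H ⧸ N) '' B' * B, (hB'.image _).mul hB, fun x a ha => ?_⟩
  have h1 := Set.mem_image_of_mem ((↑) : H → H ⧸ N) (hfB x.out a.out ⟨a, ha, rfl⟩)
  have h2 := h (x.out * a.out) (x * a).out (by simp)
  simpa [mul_assoc, quotientMap] using Set.mul_mem_mul h1 h2

theorem CoarselyDescends.quotientMap_comp_isClose [M.Normal] [N.Normal] {f : G → H} {r : H → G}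
    (hf : CoarselyDescends M N f) (hr : CoarselyDescends N M r) (h : IsCoarseMap r)
    (hrf : IsClose (fun x => r (f x)) id) :
    IsClose (fun x => quotientMap N M r (quotientMap M N f x)) id := by
  have h1 := (hr.isCoarseMap h).comp_isClose hf.isClose
  obtain ⟨B, hB, hB'⟩ := hr.isClose
  have h2 : IsClose (fun g => quotientMap N M r (f g)) (fun g => (r (f g) : G ⧸ M)) :=
    ⟨B, hB, fun g => hB' (f g)⟩
  obtain ⟨D, hD, hD'⟩ := (h1.trans h2).trans (hrf.map (QuotientGroup.mk' M))
  refine ⟨D, hD, fun x => ?_⟩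
  induction x using QuotientGroup.induction_on with
  | H g => exact hD' g

theorem IsCoarseInverse.quotientMap [M.Normal] [N.Normal] {f : G → H} {r : H → G}
    (h : IsCoarseInverse f r) (hf : CoarselyDescends M N f) (hr : CoarselyDescends N M r) :
    IsCoarseInverse (quotientMap M N f) (quotientMap N M r) :=
  ⟨hf.isCoarseMap h.coarse, hr.isCoarseMap h.coarse_inv,
    hf.quotientMap_comp_isClose hr h.coarse_inv h.left_close,
    hr.quotientMap_comp_isClose hf h.coarse h.right_close⟩

theorem CoarselyDescends.of_near [N.Normal] {f : G → H} {E : Set H} (hE : E.Finite)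
    (h : ∀ g : G, ∃ y : H ⧸ N, ∀ g' : G, (g : G ⧸ M) = g' → ∃ k : H, (k : H ⧸ N) = y ∧
      (f g')⁻¹ * k ∈ E) : CoarselyDescends M N f := by
  refine ⟨(((↑) : H → H ⧸ N) '' E) * (((↑) : H → H ⧸ N) '' E)⁻¹,
    (hE.image _).mul (hE.image _).inv, fun g g' hg => ?_⟩
  obtain ⟨y, hy⟩ := h g
  obtain ⟨k, hk, hkE⟩ := hy g rfl
  obtain ⟨k', hk', hkE'⟩ := hy g' hg
  have h1 := Set.mem_image_of_mem ((↑) : H → H ⧸ N) hkE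
  have h2 := Set.mem_image_of_mem ((↑) : H → H ⧸ N) hkE'
  simpa [hk, hk', mul_assoc] using Set.mul_mem_mul h1 (Set.inv_mem_inv.2 h2)

theorem mem_image_mul_left_iff {g g' : G} :
    g' ∈ (fun x : G => g * x) '' (M : Set G) ↔ (g : G ⧸ M) = g' := by
  rw [QuotientGroup.eq, Set.image_mul_left, Set.mem_preimage, SetLike.mem_coe]

theorem IsQuasiIsometryOfPairs.coarselyDescends [M.Normal] [N.Normal] {S : Set G} {T : Set H}
    (hT : IsFiniteGeneratingSet T) {f : G → H} {r : H → G} (h : IsCoarseInverse f r)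
    (hf : IsQuasiIsometryOfPairs (wordDist S) (wordDist T) (leftCosets M) (leftCosets N) f) :
    CoarselyDescends M N f ∧ CoarselyDescends N M r := by
  obtain ⟨-, Q, -, hQ, hQ'⟩ := hf
  obtain ⟨E, hE, hTE⟩ := hT.exists_finite_of_wordDist_le ⌊Q⌋₊
  obtain ⟨E', hE', hEE'⟩ := h.exists_transpose hE.inv
  refine ⟨.of_near hE fun g => ?_, .of_near hE' fun k => ?_⟩
  · obtain ⟨_, ⟨k, rfl⟩, hk, -⟩ := hQ _ ⟨g, rfl⟩
    refine ⟨k, fun g' hg' => ?_⟩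
    obtain ⟨k', hk', hd⟩ := hk _ ⟨g', mem_image_mul_left_iff.2 hg', rfl⟩
    exact ⟨k', (mem_image_mul_left_iff.1 hk').symm, hTE _ _ (Nat.le_floor hd)⟩
  -- Here the other half of the Hausdorff bound serves: each point of `kN` is near some `f g'` with
  -- `g' ∈ gM`, and transposing puts its image under `r` near `gM`.
  · obtain ⟨_, ⟨g, rfl⟩, -, hg⟩ := hQ' _ ⟨k, rfl⟩
    refine ⟨g, fun k' hk' => ?_⟩
    obtain ⟨_, ⟨g', hg', rfl⟩, hd⟩ := hg _ (mem_image_mul_left_iff.2 hk')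
    refine ⟨g', (mem_image_mul_left_iff.1 hg').symm, hEE' _ _ ?_⟩
    simpa using hTE _ _ (Nat.le_floor hd)

/-- Co-amenability of a normal subgroup is amenability of the quotient group. -/
theorem isCoAmenable_of_isAmenableAction_quotient [M.Normal]
    (h : IsAmenableAction (G ⧸ M) (G ⧸ M)) :
    IsCoAmenable M := by
  obtain ⟨μ, h0, h1, hadd, hinv⟩ := h
  refine ⟨μ, h0, h1, hadd, fun g A => ?_⟩
  rw [← hinv (g : G ⧸ M) A]
  congr 1

end Quotients

/-! ### Aptolic maps between wreath products -/

section Wreath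

theorem lampAction_apply {A X G : Type*} [AddCommGroup A] [Group G] [MulAction G X] (g : G)
    (c : Lamps A X) (x : X) :
    (lampAction A X G g c).toAdd x = c.toAdd (g⁻¹ • x) :=
  rfl

theorem finite_setOf_support_subset {B Y : Type*} [Finite B] [Zero B] {D : Set Y}
    (hD : D.Finite) : {c : Y →₀ B | ∀ y, c y ≠ 0 → y ∈ D}.Finite := by
  have := hD.to_subtype
  refine Set.Finite.of_finite_image (f := fun c (d : D) => c d) (Set.toFinite _) ?_
  intro c hc c' hc' h
  ext y
  by_cases hy : y ∈ D
  · exact congrFun h ⟨y, hy⟩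
  · rw [not_not.1 (mt (hc y) hy), not_not.1 (mt (hc' y) hy)]

variable {A B : Type*} [AddCommGroup A] [AddCommGroup B]
variable {G H : Type*} [Group G] [Group H] {M : Subgroup G} {N : Subgroup H}

/-- The map of aptolic form with components `α` and `f`. -/
def wreathMap (α : (G ⧸ M →₀ A) → (H ⧸ N →₀ B)) (f : G → H)
    (w : PermWreath A (G ⧸ M) G) : PermWreath B (H ⧸ N) H :=
  ⟨Multiplicative.ofAdd (α w.left.toAdd), f w.right⟩

theorem isAptolicForm_wreathMap (α : (G ⧸ M →₀ A) → (H ⧸ N →₀ B)) (f : G → H) :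
    IsAptolicForm (wreathMap α f) :=
  ⟨fun c => Multiplicative.ofAdd (α c.toAdd), f, fun _ _ => rfl⟩

/-- Multiplying `w` by `k` on the right changes the colouring only on the translate of `supp k` by
`w.right`. By locality `α` then changes only near `f w.right`. Translating back gives a fixed finite
set of positions, carrying finitely many colourings since `B` is finite. -/
theorem isCoarseMap_wreathMap [M.Normal] [N.Normal] [Finite B] {f : G → H} (hf : IsCoarseMap f)
    {φ : G ⧸ M → H ⧸ N}
    (hφ : IsCoarseMap φ) (hφf : IsClose (fun g : G => φ g) (fun g => (f g : H ⧸ N)))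
    {α : (G ⧸ M →₀ A) → (H ⧸ N →₀ B)} (hα : IsLocalRecolouring φ α) :
    IsCoarseMap (wreathMap α f) := by
  intro K hK
  obtain ⟨C, hC, hαC⟩ := hα
  obtain ⟨B₀, hB₀, hφB⟩ := hφ (⋃ k ∈ K, (k.left.toAdd.support : Set (G ⧸ M)))
    (hK.biUnion fun k _ => Finset.finite_toSet _)
  obtain ⟨B₁, hB₁, hφf⟩ := hφf
  obtain ⟨B₂, hB₂, hfB⟩ := hf ((fun k => k.right) '' K) (hK.image _)
  have hD : (B₁⁻¹ * (B₀ * C)).Finite := hB₁.inv.mul (hB₀.mul hC)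
  refine ⟨(fun z : (H ⧸ N →₀ B) × H => ⟨Multiplicative.ofAdd z.1, z.2⟩) ''
    ({c | ∀ y, c y ≠ 0 → y ∈ B₁⁻¹ * (B₀ * C)} ×ˢ B₂),
    ((finite_setOf_support_subset hD).prod hB₂).image _, fun w k hk => ?_⟩
  refine ⟨(((wreathMap α f w)⁻¹ * wreathMap α f (w * k)).left.toAdd,
    ((wreathMap α f w)⁻¹ * wreathMap α f (w * k)).right), ⟨?_, ?_⟩, rfl⟩
  · intro y hy
    have hne : α (w * k).left.toAdd ((f w.right : H ⧸ N) * y) ≠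
        α w.left.toAdd ((f w.right : H ⧸ N) * y) := by
      intro heq
      apply hy
      have : (f w.right)• y = (f w.right : H ⧸ N) * y := by
        induction y using QuotientGroup.induction_on with
        | H k => rfl
      change (lampAction B (H ⧸ N) H (f w.right)⁻¹
          (Multiplicative.ofAdd (α w.left.toAdd))⁻¹).toAdd y +
        (lampAction B (H ⧸ N) H (f w.right)⁻¹
          (Multiplicative.ofAdd (α (w * k).left.toAdd))).toAdd y = 0
      rw [lampAction_apply, lampAction_apply, inv_inv, this]
      change -(α w.left.toAdd) _ + α (w * k).left.toAdd _ = 0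
      rw [heq]
      exact neg_add_cancel (α w.left.toAdd _)
    obtain ⟨x, hx, hxC⟩ := hαC _ _ _ hne
    have hx' : k.left.toAdd ((w.right : G ⧸ M)⁻¹ * x) ≠ 0 := by
      intro h0
      apply hx
      change (w.left.toAdd + (lampAction A (G ⧸ M) G w.right k.left).toAdd) x = _
      have : w.right⁻¹ • x = (w.right : G ⧸ M)⁻¹ * x := by
        induction x using QuotientGroup.induction_on with
        | H k => rfl
      rw [Finsupp.add_apply, lampAction_apply, this, h0, add_zero]
    have h1 := hφB (w.right : G ⧸ M) ((w.right : G ⧸ M)⁻¹ * x)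
      (Set.mem_biUnion hk (by simpa using hx'))
    rw [mul_inv_cancel_left] at h1
    have := Set.mul_mem_mul (Set.inv_mem_inv.2 (hφf w.right)) (Set.mul_mem_mul h1 hxC)
    simpa [mul_assoc] using this
  · exact hfB w.right _ ⟨k, hk, rfl⟩

/-- The colouring returns exactly to itself, so the displacement lies in the base group. -/
theorem isClose_wreathMap_comp {α : (G ⧸ M →₀ A) → (H ⧸ N →₀ B)}
    {α' : (H ⧸ N →₀ B) → (G ⧸ M →₀ A)} (hα : ∀ c, α' (α c) = c) {f : G → H} {r : H → G}
    (h : IsClose (fun x => r (f x)) id) :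
    IsClose (fun w => wreathMap α' r (wreathMap α f w)) id := by
  obtain ⟨D, hD, hrf⟩ := h
  refine ⟨SemidirectProduct.inr '' D, hD.image _, fun w => ⟨_, hrf w.right, ?_⟩⟩
  rw [eq_inv_mul_iff_mul_eq]
  ext1
  · simp [wreathMap, hα]
  · simp [wreathMap]

theorem fg_permWreath [Group.FG G] (n : ℕ) : Group.FG (PermWreath (ZMod n) (G ⧸ M) G) := by
  obtain ⟨S, hS⟩ := Group.fg_def.1 ‹Group.FG G›
  let lamp : PermWreath (ZMod n) (G ⧸ M) G :=
    SemidirectProduct.inl (Multiplicative.ofAdd (Finsupp.single ((1 : G) : G ⧸ M) 1))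
  refine Group.fg_iff.2 ⟨SemidirectProduct.inr '' (S : Set G) ∪ {lamp}, ?_,
    (S.finite_toSet.image _).union (Set.finite_singleton _)⟩
  set K := Subgroup.closure (SemidirectProduct.inr '' (S : Set G) ∪ {lamp})
  have hinr : ∀ g : G, SemidirectProduct.inr g ∈ K := by
    intro g
    have : (Subgroup.closure (S : Set G)).map
        (SemidirectProduct.inr : G →* PermWreath (ZMod n) (G ⧸ M) G) ≤ K := by
      rw [MonoidHom.map_closure]
      exact Subgroup.closure_mono Set.subset_union_left
    exact this ⟨g, by rw [hS]; trivial, rfl⟩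
  have hlamp : lamp ∈ K := Subgroup.subset_closure (Or.inr rfl)
  have hinl : ∀ c : (G ⧸ M) →₀ ZMod n, SemidirectProduct.inl (Multiplicative.ofAdd c) ∈ K := by
    intro c
    induction c using Finsupp.induction_linear with
    | zero => rw [ofAdd_zero, map_one]; exact one_mem K
    | add c c' hc hc' => rw [ofAdd_add, map_mul]; exact mul_mem hc hc'
    | single x z =>
      obtain ⟨k, rfl⟩ := ZMod.intCast_surjective z
      induction x using QuotientGroup.induction_on with
      | H g =>
        -- Conjugating powers of the lamp at the trivial coset by `g` gives every colour at the
        -- coset of `g`.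
        have : (SemidirectProduct.inl (Multiplicative.ofAdd
            (Finsupp.single (g : G ⧸ M) (k : ZMod n))) : PermWreath (ZMod n) (G ⧸ M) G) =
            SemidirectProduct.inr g * lamp ^ k * SemidirectProduct.inr g⁻¹ := by
          rw [← map_zpow, ← SemidirectProduct.inl_aut, ← ofAdd_zsmul, Finsupp.smul_single,
            zsmul_one]
          congr 1
          change _ = Multiplicative.ofAdd (Finsupp.domCongr _ _)
          rw [Finsupp.domCongr_apply, toAdd_ofAdd, Finsupp.equivMapDomain_single]
          congr 2
          exact congrArg ((↑) : G → G ⧸ M) (mul_one g).symm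
        rw [this]
        exact mul_mem (mul_mem (hinr g) (zpow_mem hlamp k)) (hinr g⁻¹)
  refine eq_top_iff.2 fun w _ => ?_
  rw [← SemidirectProduct.inl_left_mul_inr_right w]
  exact mul_mem (hinl w.left.toAdd) (hinr _)

end Wreath

/-! ### The main theorem -/

theorem proposition1p7 {G H : Type*} [Group G] [Group H]
    (n m : ℕ) (hn : 2 ≤ n) (hm : 2 ≤ m)
    (S : Set G) (hS : IsFiniteGeneratingSet S)
    (T : Set H) (hT : IsFiniteGeneratingSet T)
    (M : Subgroup G) [M.Normal] (N : Subgroup H) [N.Normal]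
    (hM : ¬ IsCoAmenable M)
    (hpairs : ∃ f : G → H,
      IsQuasiIsometryOfPairs (wordDist S) (wordDist T) (leftCosets M) (leftCosets N) f)
    (hnm : ∀ p : ℕ, p.Prime → (p ∣ n ↔ p ∣ m)) :
    Group.FG (PermWreath (ZMod n) (G ⧸ M) G) ∧
    Group.FG (PermWreath (ZMod m) (H ⧸ N) H) ∧
    ∃ q : PermWreath (ZMod n) (G ⧸ M) G → PermWreath (ZMod m) (H ⧸ N) H,
      ∀ (U : Set (PermWreath (ZMod n) (G ⧸ M) G))
        (V : Set (PermWreath (ZMod m) (H ⧸ N) H)),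
        IsFiniteGeneratingSet U → IsFiniteGeneratingSet V →
          IsAptolicQuasiIsometry (wordDist U) (wordDist V) q := by
  have : Group.FG G := Group.fg_iff.2 ⟨S, hS.2, hS.1⟩
  have : Group.FG H := Group.fg_iff.2 ⟨T, hT.2, hT.1⟩
  have : NeZero n := ⟨by omega⟩
  have : NeZero m := ⟨by omega⟩
  refine ⟨fg_permWreath n, fg_permWreath m, ?_⟩
  obtain ⟨f, hf⟩ := hpairs
  obtain ⟨r, hfr⟩ := hf.1.exists_isCoarseInverse hS hT
  obtain ⟨hdf, hdr⟩ := hf.coarselyDescends hT hfr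
  have hq := hfr.quotientMap hdf hdr
  have hprime : n.primeFactors = m.primeFactors := by
    ext p
    simp only [Nat.mem_primeFactors]
    exact ⟨fun h => ⟨h.1, (hnm p h.1).1 h.2.1, by omega⟩,
      fun h => ⟨h.1, (hnm p h.1).2 h.2.1, by omega⟩⟩
  obtain ⟨α, α', hα, hα', hl, hr⟩ := exists_isLocalRecolouring hq
    (fun h => hM (isCoAmenable_of_isAmenableAction_quotient h)) (NeZero.ne n) (NeZero.ne m) hprime
  -- This involves no generating sets, so one map serves for all `U` and `V`.
  have hw : IsCoarseInverse (wreathMap α f) (wreathMap α' r) :=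
    ⟨isCoarseMap_wreathMap hfr.coarse hq.coarse hdf.isClose hα,
      isCoarseMap_wreathMap hfr.coarse_inv hq.coarse_inv hdr.isClose hα',
      isClose_wreathMap_comp hl hfr.left_close, isClose_wreathMap_comp hr hfr.right_close⟩
  exact ⟨wreathMap α f, fun U V hU hV => ⟨hw.isQuasiIsometry hU hV, isAptolicForm_wreathMap α f,
    wreathMap α' r, hw.isQuasiInverse hU hV, isAptolicForm_wreathMap α' r⟩⟩
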